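/- For $x>0$ let $\psi(x)=\Gamma'(x)/\Gamma(x)$ and $$\phi(x)=\psi(x)+\frac{1}{2x}-\log x .$$ Let $\xi(s)=(s-1)\,\pi^{-s/2}\,\Gamma\left(1+\tfrac{s}{2}\right)\zeta(s)$, where $\zeta$ is the Riemann zeta function, and let $\Xi(t)=\xi\left(\tfrac12+it\right)$ for real $t$. Let $\gamma$ denote Euler's constant. If $\alpha$ and $\beta$ are positive real numbers with $\alpha\beta=1$, then the two series and the integral below converge absolutely, and $$\sqrt{\alpha}\left\{\frac{\gamma-\log(2\pi\alpha)}{2\alpha}+\sum_{n=1}^{\infty}\phi(n\alpha)\right\} =\sqrt{\beta}\left\{\frac{\gamma-\log(2\pi\beta)}{2\beta}+\sum_{n=1}^{\infty}\phi(n\beta)\right\} =-\frac{1}{\pi^{3/2}}\int_0^{\infty}\left|\Xi\left(\tfrac12 t\right)\Gamma\left(\frac{-1+it}{4}\right)\right|^2\frac{\cos\left(\tfrac12 t\log\alpha\right)}{1+t^2}\,dt .$$ -/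

import Mathlib

namespace RamanujanXi

/-- The logarithmic derivative `ψ(x) = Γ'(x) / Γ(x)` of the Gamma function, at a real argument. -/
noncomputable def psi (x : ℝ) : ℝ := logDeriv Real.Gamma x

/-- `φ(x) = ψ(x) + 1 / (2x) - log x`. -/
noncomputable def phi (x : ℝ) : ℝ := psi x + 1 / (2 * x) - Real.log x

/-- `ξ(s) = (s - 1) π^{-s/2} Γ(1 + s/2) ζ(s)`, by the explicit formula. The formula has removable
singularities at `s = 1` and `s = -2, -4, …`; it is only used on the line `Re s = 1/2`. -/
noncomputable def xi (s : ℂ) : ℂ :=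
  (s - 1) * (Real.pi : ℂ) ^ (-(s / 2)) * Complex.Gamma (1 + s / 2) * riemannZeta s

/-- Riemann's function `Ξ(t) = ξ(1/2 + i t)` for real `t`. -/
noncomputable def Xi (t : ℝ) : ℂ := xi (1 / 2 + Complex.I * (t : ℂ))

/-- `√α ((γ - log (2πα)) / (2α) + ∑_{n ≥ 1} φ(n α))`. -/
noncomputable def side (α : ℝ) : ℝ :=
  Real.sqrt α *
    ((Real.eulerMascheroniConstant - Real.log (2 * Real.pi * α)) / (2 * α)
      + ∑' n : ℕ, phi (((n : ℝ) + 1) * α))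

/-- `|Ξ(t/2) Γ((-1 + i t)/4)|² cos((t/2) log α) / (1 + t²)`. -/
noncomputable def integrand (α t : ℝ) : ℝ :=
  ‖Xi (t / 2) * Complex.Gamma ((-1 + Complex.I * (t : ℂ)) / 4)‖ ^ 2
    * (Real.cos (t / 2 * Real.log α) / (1 + t ^ 2))

end RamanujanXi

/-! Write B(x) = 1/(eˣ - 1) - 1/x. Binet's formula (`phi_eq_neg_binetIntegral`) makes φ(y) minus the
Laplace transform of B + 1/2, so a geometric series turns ∑ φ(na) into -∫ (B(x) + 1/2) / (e^{ax} -
1) dx (`hasSum_phi`). Splitting off the pole 1/(ax) leaves -∫ B(x) B(ax) dx and a remainder whose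
integral, found from the Laurent behaviour of ζ at 1 and from ζ(0), ζ'(0) (`integral_boseMix`),
cancels the logarithmic term. Hence `side a` = -√a ∫ B(x) B(ax) dx (`side_eq`).

For 0 < Re s < 1 the Mellin transform of B is Γ(s)ζ(s) (`hasMellin_boseReg`). Parseval on Re s = 1/2
turns √a ∫ B(x) B(ax) dx into a cosine integral of |Γζ|² (`sqrt_mul_integral_boseReg`), and the
duplication formula rewrites |Γζ|² through Ξ (`norm_Xi_mul_Gamma_sq`). The symmetry α ↔ 1/α is then
the evenness of the cosine in log α. -/

namespace RamanujanXi

/-! ### Elementary bounds for the Bose–Einstein kernel -/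

open Real Set Filter Topology MeasureTheory

/-- The Bose–Einstein kernel `1 / (eˣ - 1)`. -/
noncomputable def bose (x : ℝ) : ℝ := 1 / (exp x - 1)

/-- The Bose–Einstein kernel with its pole at the origin removed. -/
noncomputable def boseReg (x : ℝ) : ℝ := bose x - 1 / x

lemma exp_sub_one_pos {x : ℝ} (hx : 0 < x) : 0 < exp x - 1 := by
  have := add_one_lt_exp hx.ne'
  linarith

lemma bose_pos {x : ℝ} (hx : 0 < x) : 0 < bose x := by
  have := exp_sub_one_pos hx
  unfold bose
  positivity

lemma add_sq_div_two_le {x : ℝ} (hx : 0 < x) : x + x ^ 2 / 2 ≤ exp x - 1 := by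
  have := quadratic_le_exp_of_nonneg hx.le
  linarith

lemma bose_le {x : ℝ} (hx : 0 < x) : bose x ≤ 1 / (x + x ^ 2 / 2) :=
  one_div_le_one_div_of_le (by positivity) (add_sq_div_two_le hx)

lemma bose_le_inv {x : ℝ} (hx : 0 < x) : bose x ≤ 1 / x :=
  (bose_le hx).trans (one_div_le_one_div_of_le hx (by nlinarith))

lemma bose_le_two_div_sq {x : ℝ} (hx : 0 < x) : bose x ≤ 2 / x ^ 2 := by
  refine (bose_le hx).trans ?_
  rw [div_le_div_iff₀ (by positivity) (by positivity)]
  nlinarith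

lemma boseReg_nonpos {x : ℝ} (hx : 0 < x) : boseReg x ≤ 0 := by
  have := bose_le_inv hx
  unfold boseReg
  linarith

/-- This is `-(1 / 2) ≤ boseReg x` with the denominators cleared. The difference of the two sides
vanishes at 0 and has derivative 1 - (1 - y)e^y ≥ 0. -/
lemma two_sub_mul_exp_le {x : ℝ} (hx : 0 ≤ x) : (2 - x) * exp x ≤ 2 + x := by
  have key : MonotoneOn (fun x : ℝ => (2 + x) - (2 - x) * exp x) (Ici 0) := by
    have hd : ∀ y : ℝ, HasDerivAt (fun x : ℝ => (2 + x) - (2 - x) * exp x)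
        (1 - (1 - y) * exp y) y := by
      intro y
      have h := ((hasDerivAt_id y).const_add 2).sub
        (((hasDerivAt_id y).const_sub 2).mul (hasDerivAt_exp y))
      refine h.congr_deriv ?_
      simp only [id]
      ring
    refine monotoneOn_of_deriv_nonneg (convex_Ici 0) (by fun_prop) (by fun_prop) fun y _ => ?_
    rw [(hd y).deriv]
    have h1 := one_sub_le_exp_neg y
    have h2 := exp_pos y
    have h3 : exp (-y) * exp y = 1 := by rw [← exp_add]; simp
    nlinarith
  have := key (mem_Ici.2 le_rfl) (mem_Ici.2 hx) hx
  norm_num at this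
  linarith

lemma neg_half_le_boseReg {x : ℝ} (hx : 0 < x) : -(1 / 2) ≤ boseReg x := by
  have h := two_sub_mul_exp_le hx.le
  have h1 := exp_sub_one_pos hx
  unfold boseReg bose
  rw [div_sub_div _ _ h1.ne' hx.ne', neg_eq_neg_one_mul, ← mul_one_div, mul_one_div, le_div_iff₀ (by positivity)]
  nlinarith

lemma boseReg_add_half_nonneg {x : ℝ} (hx : 0 < x) : 0 ≤ boseReg x + 1 / 2 := by
  have := neg_half_le_boseReg hx
  linarith

lemma boseReg_add_half_le {x : ℝ} (hx : 0 < x) : boseReg x + 1 / 2 ≤ x / 4 := by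
  have h := bose_le hx
  have : 1 / (x + x ^ 2 / 2) - 1 / x + 1 / 2 ≤ x / 4 := by
    have h2 : 1 / (x + x ^ 2 / 2) - 1 / x + 1 / 2 = x / (4 + 2 * x) := by
      field_simp
      ring
    rw [h2, div_le_div_iff₀ (by positivity) (by positivity)]
    nlinarith
  unfold boseReg
  linarith

lemma abs_boseReg_le_half {x : ℝ} (hx : 0 < x) : |boseReg x| ≤ 1 / 2 :=
  abs_le.2 ⟨neg_half_le_boseReg hx, (boseReg_nonpos hx).trans (by norm_num)⟩

lemma abs_boseReg_le_inv {x : ℝ} (hx : 0 < x) : |boseReg x| ≤ 1 / x := by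
  rw [abs_of_nonpos (boseReg_nonpos hx)]
  have := bose_pos hx
  unfold boseReg
  linarith

lemma hasDerivAt_bose {x : ℝ} (hx : 0 < x) : HasDerivAt bose (-(bose x + bose x ^ 2)) x := by
  have h1 := exp_sub_one_pos hx
  have h := ((hasDerivAt_exp x).sub_const 1).inv h1.ne'
  have e : bose = (fun x => exp x - 1)⁻¹ := by
    ext y
    simp [bose]
  rw [e]
  refine h.congr_deriv ?_
  simp only [Pi.inv_apply]
  field_simp
  ring

lemma hasDerivAt_boseReg {x : ℝ} (hx : 0 < x) :
    HasDerivAt boseReg (1 / x ^ 2 - bose x - bose x ^ 2) x := by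
  have h := (hasDerivAt_bose hx).sub (hasDerivAt_inv hx.ne')
  have e : boseReg = bose - fun x => x⁻¹ := by
    ext y
    simp [boseReg]
  rw [e]
  refine h.congr_deriv ?_
  field_simp
  ring

lemma abs_deriv_boseReg_le_half {x : ℝ} (hx : 0 < x) :
    |1 / x ^ 2 - bose x - bose x ^ 2| ≤ 1 / 2 := by
  have h1 := neg_half_le_boseReg hx
  have h2 := boseReg_add_half_le hx
  have h3 := bose_pos hx
  have h4 := bose_le_inv hx
  have h5 : boseReg x = bose x - 1 / x := rfl
  have hi : 0 < 1 / x := by positivity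
  have hxi : x * (1 / x) = 1 := by field_simp
  -- Factoring the difference of squares 1/x² - `bose x`² exposes the cancellation of the double
  -- pole.
  have e : 1 / x ^ 2 - bose x - bose x ^ 2 = -boseReg x * (1 / x + bose x) - bose x := by
    rw [h5]; field_simp; ring
  rw [e, abs_le]
  constructor
  · have h6 : (1 / 2 - x / 4) * (1 / x + bose x) ≤ -boseReg x * (1 / x + bose x) :=
      mul_le_mul_of_nonneg_right (by linarith) (by linarith)
    have h7 : x * bose x ≤ 1 := by
      calc x * bose x ≤ x * (1 / x) := by gcongr
        _ = 1 := hxi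
    nlinarith
  · have h6 : -boseReg x * (1 / x + bose x) ≤ 1 / 2 * (1 / x + bose x) :=
      mul_le_mul_of_nonneg_right (by linarith) (by linarith)
    nlinarith

lemma abs_deriv_boseReg_le_div_sq {x : ℝ} (hx : 1 ≤ x) :
    |1 / x ^ 2 - bose x - bose x ^ 2| ≤ 4 / x ^ 2 := by
  have hx0 : 0 < x := by linarith
  have h3 := bose_pos hx0
  have h4 := bose_le_inv hx0
  have h5 := bose_le_two_div_sq hx0
  have h6 : 1 / x ≤ 1 := by rw [div_le_one hx0]; exact hx
  have h7 : 0 < 1 / x ^ 2 := by positivity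
  have e2 : 2 / x ^ 2 = 2 * (1 / x ^ 2) := by ring
  have e4 : 4 / x ^ 2 = 4 * (1 / x ^ 2) := by ring
  rw [abs_le]
  constructor
  · nlinarith
  · nlinarith

lemma continuousOn_bose : ContinuousOn bose (Ioi 0) := fun _ hx =>
  (hasDerivAt_bose hx).continuousAt.continuousWithinAt

lemma measurable_bose : Measurable bose := by
  unfold bose
  fun_prop

lemma measurable_boseReg : Measurable boseReg := by
  unfold boseReg
  have := measurable_bose
  fun_prop

/-- Geometric expansion of the Bose–Einstein kernel. -/
lemma hasSum_bose {x : ℝ} (hx : 0 < x) :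
    HasSum (fun n : ℕ => exp (-((n + 1 : ℝ) * x))) (bose x) := by
  have h := (hasSum_geometric_of_lt_one (exp_pos (-x)).le (by simpa using hx)).mul_left (exp (-x))
  have h1 := exp_sub_one_pos hx
  have e : ∀ n : ℕ, exp (-((n + 1 : ℝ) * x)) = exp (-x) * exp (-x) ^ n := fun n => by
    rw [← Real.exp_nat_mul, ← Real.exp_add]
    ring_nf
  have e' : bose x = exp (-x) * (1 - exp (-x))⁻¹ := by
    simp only [bose, Real.exp_neg]
    have : 1 - (exp x)⁻¹ ≠ 0 := by
      have : (exp x)⁻¹ < 1 := inv_lt_one_of_one_lt₀ (by linarith)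
      linarith
    field_simp
  rw [e']
  simpa only [e] using h

end RamanujanXi

/-! ### Binet's formula for the digamma function and the sum over n -/

namespace RamanujanXi

open Real Set Filter Topology MeasureTheory

lemma psi_eq_deriv {y : ℝ} (hy : 0 < y) : psi y = deriv (log ∘ Gamma) y := by
  have hd : DifferentiableAt ℝ Gamma y :=
    differentiableAt_Gamma fun m => by have := Nat.cast_nonneg (α := ℝ) m; linarith
  have h : HasDerivAt (log ∘ Gamma) (deriv Gamma y / Gamma y) y := hd.hasDerivAt.log (Gamma_pos_of_pos hy).ne'
  rw [psi, logDeriv_apply, h.deriv]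

lemma differentiableAt_log_Gamma {y : ℝ} (hy : 0 < y) : DifferentiableAt ℝ (log ∘ Gamma) y := by
  have hd : DifferentiableAt ℝ Gamma y :=
    differentiableAt_Gamma fun m => by have := Nat.cast_nonneg (α := ℝ) m; linarith
  exact hd.log (Gamma_pos_of_pos hy).ne'

lemma psi_add_one {y : ℝ} (hy : 0 < y) : psi (y + 1) = psi y + 1 / y := by
  rw [psi_eq_deriv hy, psi_eq_deriv (by positivity), ← deriv_comp_add_const]
  have h : (fun x => (log ∘ Gamma) (x + 1)) =ᶠ[𝓝 y] fun x => (log ∘ Gamma) x + log x := by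
    filter_upwards [lt_mem_nhds hy] with x hx
    simp only [Function.comp]
    rw [Gamma_add_one hx.ne', log_mul hx.ne' (Gamma_pos_of_pos hx).ne', add_comm]
  rw [h.deriv_eq, deriv_fun_add (differentiableAt_log_Gamma hy) (differentiableAt_log hy.ne'),
    deriv_log, one_div]

/-- By convexity of log Γ this secant slope lies between ψ(y) and ψ(y + 1), which gives both bounds
on ψ. -/
lemma slope_log_Gamma {y : ℝ} (hy : 0 < y) : slope (log ∘ Gamma) y (y + 1) = log y := by
  simp only [slope, Function.comp, vsub_eq_sub, smul_eq_mul]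
  rw [Gamma_add_one hy.ne', log_mul hy.ne' (Gamma_pos_of_pos hy).ne']
  simp

lemma psi_le_log {y : ℝ} (hy : 0 < y) : psi y ≤ log y := by
  rw [psi_eq_deriv hy, ← slope_log_Gamma hy]
  exact convexOn_log_Gamma.deriv_le_slope hy (by simp; positivity) (by linarith)
    (differentiableAt_log_Gamma hy)

lemma log_sub_inv_le_psi {y : ℝ} (hy : 0 < y) : log y - 1 / y ≤ psi y := by
  have h : slope (log ∘ Gamma) y (y + 1) ≤ deriv (log ∘ Gamma) (y + 1) :=
    convexOn_log_Gamma.slope_le_deriv hy (by simp; positivity) (by linarith)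
      (differentiableAt_log_Gamma (by positivity))
  rw [slope_log_Gamma hy, ← psi_eq_deriv (by positivity), psi_add_one hy] at h
  linarith

lemma abs_phi_le {y : ℝ} (hy : 0 < y) : |phi y| ≤ 1 / (2 * y) := by
  have h1 := psi_le_log hy
  have h2 := log_sub_inv_le_psi hy
  have h3 : 1 / y = 1 / (2 * y) + 1 / (2 * y) := by field_simp; ring
  unfold phi
  rw [abs_le]
  constructor <;> linarith

lemma integrableOn_boseReg_add_half_mul_exp {y : ℝ} (hy : 0 < y) :
    IntegrableOn (fun x => (boseReg x + 1 / 2) * exp (-y * x)) (Ioi 0) := by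
  refine ((exp_neg_integrableOn_Ioi 0 hy).const_mul (1 / 2)).mono'
    ((measurable_boseReg.add_const _).mul (by fun_prop)).aestronglyMeasurable ?_
  refine (ae_restrict_mem measurableSet_Ioi).mono fun x hx => ?_
  rw [norm_mul, norm_of_nonneg (boseReg_add_half_nonneg hx), norm_of_nonneg (exp_pos _).le]
  have := boseReg_nonpos hx
  gcongr
  linarith

/-- The Laplace transform of `1 / (eˣ - 1) - 1 / x + 1 / 2`. -/
noncomputable def binetIntegral (y : ℝ) : ℝ :=
  ∫ x in Ioi 0, (boseReg x + 1 / 2) * exp (-y * x)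

lemma binetIntegral_nonneg (y : ℝ) : 0 ≤ binetIntegral y :=
  setIntegral_nonneg measurableSet_Ioi fun _ hx =>
    mul_nonneg (boseReg_add_half_nonneg hx) (exp_pos _).le

lemma integral_exp_neg_mul {y : ℝ} (hy : 0 < y) : ∫ x in Ioi 0, exp (-y * x) = 1 / y := by
  rw [integral_exp_mul_Ioi (by linarith)]
  simp

lemma abs_binetIntegral_le {y : ℝ} (hy : 0 < y) : |binetIntegral y| ≤ 1 / (2 * y) := by
  have h : 1 / (2 * y) = ∫ x in Ioi 0, 1 / 2 * exp (-y * x) := by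
    rw [integral_const_mul, integral_exp_neg_mul hy]
    field_simp
  rw [abs_of_nonneg (binetIntegral_nonneg y), h]
  refine setIntegral_mono_on (integrableOn_boseReg_add_half_mul_exp hy)
    ((exp_neg_integrableOn_Ioi 0 hy).const_mul _) measurableSet_Ioi fun x hx => ?_
  have := boseReg_nonpos hx
  gcongr
  linarith

lemma integral_mul_exp_neg_mul {y : ℝ} (hy : 0 < y) :
    ∫ x in Ioi 0, x * exp (-y * x) = 1 / y ^ 2 := by
  have h := integral_rpow_mul_exp_neg_mul_Ioi (a := 2) two_pos hy
  norm_num at h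
  simpa using h

lemma integrableOn_mul_exp_neg_mul {y : ℝ} (hy : 0 < y) :
    IntegrableOn (fun x => x * exp (-y * x)) (Ioi 0) := by
  have h := integrableOn_rpow_mul_exp_neg_mul_rpow (p := 1) (s := 1) (by norm_num) one_pos hy
  simpa using h

/-- The bound `abs_binetIntegral_le` is not summable along y = na; `boseReg x + 1 / 2` ≤ x/4
supplies the quadratic decay. -/
lemma binetIntegral_le_sq {y : ℝ} (hy : 0 < y) : binetIntegral y ≤ 1 / 4 * (1 / y ^ 2) := by
  rw [← integral_mul_exp_neg_mul hy, ← integral_const_mul]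
  refine setIntegral_mono_on (integrableOn_boseReg_add_half_mul_exp hy)
    ((integrableOn_mul_exp_neg_mul hy).const_mul _) measurableSet_Ioi fun x hx => ?_
  rw [← mul_assoc]
  have := boseReg_add_half_le hx
  gcongr
  linarith

/-- The difference carries a factor 1 - e^{-x}, which cancels the denominator of `bose`. What
remains is pure exponentials and the Frullani integrand (e^{-yx} - e^{-(y+1)x})/x. -/
lemma binetIntegral_sub {y : ℝ} (hy : 0 < y) :
    binetIntegral y - binetIntegral (y + 1) =
      1 / 2 * (1 / y + 1 / (y + 1)) - log ((y + 1) / y) := by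
  have hy1 : 0 < y + 1 := by positivity
  have hpt : ∀ x ∈ Ioi (0 : ℝ), x⁻¹ * (exp (-(y * x)) - exp (-((y + 1) * x))) =
      1 / 2 * (exp (-y * x) + exp (-(y + 1) * x)) -
        ((boseReg x + 1 / 2) * exp (-y * x) - (boseReg x + 1 / 2) * exp (-(y + 1) * x)) := by
    intro x hx
    have h1 := exp_sub_one_pos hx
    have h2 : exp (-y * x) = exp (-(y + 1) * x) * exp x := by rw [← exp_add]; ring_nf
    rw [← neg_mul, ← neg_mul, h2]
    have hx' : x ≠ 0 := (mem_Ioi.1 hx).ne'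
    unfold boseReg bose
    field_simp
    ring
  have i1 := ((exp_neg_integrableOn_Ioi 0 hy).add (exp_neg_integrableOn_Ioi 0 hy1)).const_mul (1 / 2)
  have i2 := (integrableOn_boseReg_add_half_mul_exp hy).sub
    (integrableOn_boseReg_add_half_mul_exp hy1)
  have hF := Frullani.integral_Ioi_eq (f := fun x : ℝ => exp (-x)) (a := y) (b := y + 1) (L := 1)
    (R := 0) ((by fun_prop : Continuous fun x : ℝ => exp (-x)).locallyIntegrable.locallyIntegrableOn _)
    hy hy1
    (by
      have : Continuous fun x : ℝ => exp (-x) := by fun_prop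
      simpa using this.continuousWithinAt (s := Ioi 0) (x := 0) |>.tendsto)
    tendsto_exp_neg_atTop_nhds_zero
    ((integrableOn_congr_fun hpt measurableSet_Ioi).2 (i1.sub i2))
  simp only [smul_eq_mul, sub_zero, mul_one] at hF
  rw [setIntegral_congr_fun measurableSet_Ioi hpt] at hF
  have e1 := integral_sub i1 i2
  have e2 := integral_sub (integrableOn_boseReg_add_half_mul_exp hy)
    (integrableOn_boseReg_add_half_mul_exp hy1)
  have e3 := integral_add (exp_neg_integrableOn_Ioi 0 hy) (exp_neg_integrableOn_Ioi 0 hy1)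
  simp only [Pi.add_apply, Pi.sub_apply] at e1 e2 e3
  rw [e1, integral_const_mul, e2, e3, integral_exp_neg_mul hy, integral_exp_neg_mul hy1] at hF
  unfold binetIntegral
  linarith

lemma phi_sub {y : ℝ} (hy : 0 < y) :
    phi (y + 1) - phi y = 1 / 2 * (1 / y + 1 / (y + 1)) - log ((y + 1) / y) := by
  rw [phi, phi, psi_add_one hy, log_div (by positivity) hy.ne']
  field_simp
  ring

/-- **Binet's formula** for the digamma function. -/
theorem phi_eq_neg_binetIntegral {y : ℝ} (hy : 0 < y) : phi y = -binetIntegral y := by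
  -- Both terms satisfy the same difference equation up to sign, so their sum is unchanged by y ↦ y
  -- + n; it is also O(1/(y + n)), hence 0.
  have hper : ∀ n : ℕ, phi (y + n) + binetIntegral (y + n) = phi y + binetIntegral y := by
    intro n
    induction n with
    | zero => simp
    | succ n ih =>
      have hn : 0 < y + n := by positivity
      have h1 := phi_sub hn
      have h2 := binetIntegral_sub hn
      push_cast
      rw [← add_assoc]
      linarith
  have hlim : Tendsto (fun n : ℕ => phi (y + n) + binetIntegral (y + n)) atTop (𝓝 0) := by
    have hb : Tendsto (fun n : ℕ => 1 / (y + n)) atTop (𝓝 0) := by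
      simp only [one_div]
      exact (tendsto_atTop_add_const_left _ y tendsto_natCast_atTop_atTop).inv_tendsto_atTop
    refine squeeze_zero_norm (fun n => ?_) hb
    have hn : 0 < y + n := by positivity
    calc ‖phi (y + n) + binetIntegral (y + n)‖ ≤ |phi (y + n)| + |binetIntegral (y + n)| :=
          abs_add_le _ _
      _ ≤ 1 / (2 * (y + n)) + 1 / (2 * (y + n)) :=
          add_le_add (abs_phi_le hn) (abs_binetIntegral_le hn)
      _ = 1 / (y + n) := by field_simp; ring
  have := tendsto_nhds_unique (tendsto_const_nhds.congr fun n => (hper n).symm) hlim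
  linarith

/-- The integrands are nonnegative, so their L¹ norms are the values of `binetIntegral`, summable by
the quadratic bound; this permits exchanging sum and integral. -/
lemma hasSum_phi {a : ℝ} (ha : 0 < a) :
    HasSum (fun n : ℕ => phi (((n : ℝ) + 1) * a))
      (-∫ x in Ioi 0, (boseReg x + 1 / 2) * bose (a * x)) := by
  have hpos : ∀ n : ℕ, 0 < ((n : ℝ) + 1) * a := fun n => by positivity
  have e : ∀ n : ℕ, phi (((n : ℝ) + 1) * a) = -binetIntegral (((n : ℝ) + 1) * a) :=
    fun n => phi_eq_neg_binetIntegral (hpos n)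
  simp only [e]
  refine HasSum.neg ?_
  have h := hasSum_integral_of_summable_integral_norm (μ := volume.restrict (Ioi (0 : ℝ)))
    (F := fun (n : ℕ) x => (boseReg x + 1 / 2) * exp (-(((n : ℝ) + 1) * a) * x))
    (fun n => integrableOn_boseReg_add_half_mul_exp (hpos n)) (by
      have hn : ∀ n : ℕ, ∫ x in Ioi 0, ‖(boseReg x + 1 / 2) * exp (-(((n : ℝ) + 1) * a) * x)‖ =
          binetIntegral (((n : ℝ) + 1) * a) := fun n =>
        setIntegral_congr_fun measurableSet_Ioi fun x hx => norm_of_nonneg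
          (mul_nonneg (boseReg_add_half_nonneg hx) (exp_pos _).le)
      simp only [hn]
      refine Summable.of_nonneg_of_le (fun n => binetIntegral_nonneg _)
        (fun n => binetIntegral_le_sq (hpos n)) ?_
      have hs := (summable_nat_add_iff 1).2 (summable_one_div_nat_pow.2 one_lt_two)
      refine (hs.mul_left (1 / 4 * (1 / a ^ 2))).congr fun n => ?_
      push_cast
      field_simp)
  have e2 : ∫ x in Ioi 0, ∑' n : ℕ, (boseReg x + 1 / 2) * exp (-(((n : ℝ) + 1) * a) * x) =
      ∫ x in Ioi 0, (boseReg x + 1 / 2) * bose (a * x) := by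
    refine setIntegral_congr_fun measurableSet_Ioi fun x hx => ?_
    have hx0 : 0 < a * x := mul_pos ha hx
    rw [← ((hasSum_bose hx0).mul_left (boseReg x + 1 / 2)).tsum_eq]
    simp only [neg_mul, mul_assoc]
  rw [e2] at h
  exact h

end RamanujanXi

/-! ### Mellin transform of the kernel and its continuation to the critical strip -/

namespace RamanujanXi

open Set Filter Topology MeasureTheory Asymptotics

lemma bose_isBigO_exp_neg : (fun x => (bose x : ℂ)) =O[atTop] fun x => Real.exp (-1 * x) := by
  refine IsBigO.of_bound 2 ((eventually_ge_atTop 1).mono fun x hx => ?_)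
  have hx0 : 0 < x := by linarith
  rw [Complex.norm_real, Real.norm_of_nonneg (bose_pos hx0).le,
    Real.norm_of_nonneg (Real.exp_pos _).le, neg_one_mul, Real.exp_neg, ← div_eq_mul_inv]
  have := Real.add_one_le_exp x
  rw [bose, div_le_div_iff₀ (exp_sub_one_pos hx0) (Real.exp_pos _)]
  linarith

lemma locallyIntegrableOn_bose : LocallyIntegrableOn (fun x => (bose x : ℂ)) (Ioi 0) :=
  (Complex.continuous_ofReal.comp_continuousOn continuousOn_bose).locallyIntegrableOn
    measurableSet_Ioi

lemma bose_isBigO_rpow_neg_one :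
    (fun x => (bose x : ℂ)) =O[𝓝[>] 0] fun x : ℝ => x ^ (-(1 : ℝ)) := by
  refine IsBigO.of_bound 1 (eventually_nhdsWithin_of_forall fun x hx => ?_)
  have hx0 : 0 < x := hx
  rw [Complex.norm_real, Real.norm_of_nonneg (bose_pos hx0).le, Real.rpow_neg_one,
    Real.norm_of_nonneg (by positivity), one_mul, ← one_div]
  exact bose_le_inv hx0

lemma mellinConvergent_bose {s : ℂ} (hs : 1 < s.re) :
    MellinConvergent (fun x => (bose x : ℂ)) s :=
  mellinConvergent_of_isBigO_rpow_exp one_pos locallyIntegrableOn_bose bose_isBigO_exp_neg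
    bose_isBigO_rpow_neg_one hs

lemma mellin_bose {s : ℂ} (hs : 1 < s.re) :
    mellin (fun x => (bose x : ℂ)) s = Complex.Gamma s * riemannZeta s := by
  have h := hasSum_mellin (a := fun _ : ℕ => (1 : ℂ)) (p := fun n : ℕ => (n : ℝ) + 1)
    (F := fun x => (bose x : ℂ)) (s := s) (fun n => Or.inr (by positivity)) (by linarith)
    (fun t ht => by
      have := Complex.hasSum_ofReal.2 (hasSum_bose ht)
      simpa only [one_mul, neg_mul] using this)
    (by
      have := (summable_nat_add_iff 1).2 (Real.summable_one_div_nat_rpow.2 hs)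
      simpa using this)
  rw [← h.tsum_eq, zeta_eq_tsum_one_div_nat_add_one_cpow hs, ← tsum_mul_left]
  simp [div_eq_mul_inv]

/-- The Bose–Einstein kernel minus `1 / x` on `(0, 1]`. -/
noncomputable def boseTrunc (x : ℝ) : ℂ :=
  bose x - (Ioc (0 : ℝ) 1).indicator (fun t : ℝ => (t : ℂ) ^ (-1 : ℂ)) x

lemma boseTrunc_of_mem_Ioc {x : ℝ} (hx : x ∈ Ioc (0 : ℝ) 1) : boseTrunc x = boseReg x := by
  rw [boseTrunc, indicator_of_mem hx, Complex.cpow_neg_one, boseReg]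
  push_cast
  rw [one_div]

lemma boseTrunc_of_one_lt {x : ℝ} (hx : 1 < x) : boseTrunc x = bose x := by
  rw [boseTrunc, indicator_of_notMem (fun h => hx.not_ge h.2), sub_zero]

lemma locallyIntegrableOn_boseTrunc : LocallyIntegrableOn boseTrunc (Ioi 0) := by
  refine locallyIntegrableOn_bose.sub ?_
  have h : LocallyIntegrableOn (fun t : ℝ => (t : ℂ) ^ (-1 : ℂ)) (Ioi 0) := by
    refine ContinuousOn.locallyIntegrableOn (fun t ht => ?_) measurableSet_Ioi
    exact (Complex.continuousAt_ofReal_cpow_const _ _ (Or.inr (ne_of_gt ht))).continuousWithinAt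
  intro x hx
  obtain ⟨t, ht, hi⟩ := h x hx
  exact ⟨t, ht, hi.indicator measurableSet_Ioc⟩

lemma boseTrunc_isBigO_exp_neg : boseTrunc =O[atTop] fun x => Real.exp (-1 * x) :=
  bose_isBigO_exp_neg.congr' ((eventually_gt_atTop 1).mono fun _ hx =>
    (boseTrunc_of_one_lt hx).symm) EventuallyEq.rfl

lemma boseTrunc_isBigO_one : boseTrunc =O[𝓝[>] 0] fun x : ℝ => x ^ (-(0 : ℝ)) := by
  refine IsBigO.of_bound (1 / 2) ?_
  filter_upwards [Ioc_mem_nhdsGT one_pos] with x hx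
  rw [boseTrunc_of_mem_Ioc hx, Complex.norm_real]
  simpa using abs_boseReg_le_half hx.1

/-- Removing the pole on (0, 1] only keeps the exponential decay at infinity, so boundedness near 0
is all that limits s. -/
lemma mellinConvergent_boseTrunc {s : ℂ} (hs : 0 < s.re) : MellinConvergent boseTrunc s :=
  mellinConvergent_of_isBigO_rpow_exp one_pos locallyIntegrableOn_boseTrunc
    boseTrunc_isBigO_exp_neg boseTrunc_isBigO_one hs

lemma differentiableAt_mellin_boseTrunc {s : ℂ} (hs : 0 < s.re) :
    DifferentiableAt ℂ (mellin boseTrunc) s :=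
  mellin_differentiableAt_of_isBigO_rpow_exp one_pos locallyIntegrableOn_boseTrunc
    boseTrunc_isBigO_exp_neg boseTrunc_isBigO_one hs

lemma mellin_boseTrunc_of_one_lt {s : ℂ} (hs : 1 < s.re) :
    (s - 1) * mellin boseTrunc s = Complex.Gamma s * riemannZeta₁ s - 1 := by
  have hs1 : s ≠ 1 := by rintro rfl; simp at hs
  have h1 := hasMellin_cpow_Ioc (-1) (s := s) (by simp; linarith)
  have h2 := (hasMellin_sub (mellinConvergent_bose hs) h1.1).2
  have e : mellin boseTrunc s = _ := h2
  rw [e, mellin_bose hs, h1.2, riemannZeta_eq_inv_sub_mul hs1]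
  have : s - 1 ≠ 0 := sub_ne_zero.2 hs1
  have h3 : s + -1 = s - 1 := by ring
  rw [h3]
  field_simp

/-- The factor s - 1 clears the pole of ζ, so both sides are analytic on Re s > 0 and the identity
theorem extends the case Re s > 1. -/
lemma mellin_boseTrunc {s : ℂ} (hs : 0 < s.re) :
    (s - 1) * mellin boseTrunc s = Complex.Gamma s * riemannZeta₁ s - 1 := by
  have hopen : IsOpen {z : ℂ | 0 < z.re} := isOpen_lt continuous_const Complex.continuous_re
  have hpre : IsPreconnected {z : ℂ | 0 < z.re} := (convex_halfSpace_re_gt 0).isPreconnected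
  have hf : AnalyticOnNhd ℂ (fun z => (z - 1) * mellin boseTrunc z) {z : ℂ | 0 < z.re} :=
    DifferentiableOn.analyticOnNhd (fun z hz => ((differentiableAt_id.sub_const 1).mul
      (differentiableAt_mellin_boseTrunc hz)).differentiableWithinAt) hopen
  have hg : AnalyticOnNhd ℂ (fun z => Complex.Gamma z * riemannZeta₁ z - 1) {z : ℂ | 0 < z.re} :=
    DifferentiableOn.analyticOnNhd (fun z hz => (((Complex.differentiableAt_Gamma z fun m h => by
      have hz' : 0 < z.re := hz
      rw [h] at hz'
      have := Nat.cast_nonneg (α := ℝ) m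
      simp at hz'
      linarith).mul differentiable_riemannZeta₁.differentiableAt).sub_const
        1).differentiableWithinAt) hopen
  refine hf.eqOn_of_preconnected_of_eventuallyEq hg hpre (z₀ := 2) (by simp) ?_ hs
  have : {z : ℂ | 1 < z.re} ∈ 𝓝 (2 : ℂ) :=
    (isOpen_lt continuous_const Complex.continuous_re).mem_nhds (by simp)
  filter_upwards [this] with z hz using mellin_boseTrunc_of_one_lt hz

/-- In the critical strip, `Γ(s) ζ(s)` is the Mellin transform of `1 / (eˣ - 1) - 1 / x`. -/
theorem hasMellin_boseReg {s : ℂ} (hs0 : 0 < s.re) (hs1 : s.re < 1) :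
    HasMellin (fun x => (boseReg x : ℂ)) s (Complex.Gamma s * riemannZeta s) := by
  have hs : s ≠ 1 := by rintro rfl; simp at hs1
  have hre : (s - 2).re < -1 := by simp; linarith
  -- For Re s < 1 the rest of 1/x, on (1, ∞), can be subtracted too; its transform cancels the -1 in
  -- `mellin_boseTrunc`.
  have htail : HasMellin ((Ioi (1 : ℝ)).indicator fun t : ℝ => (t : ℂ) ^ (-1 : ℂ)) s
      (-(1 / (s - 1))) := by
    have e : ∀ t ∈ Ioi (0 : ℝ), (t : ℂ) ^ (s - 1) •
        (Ioi (1 : ℝ)).indicator (fun t : ℝ => (t : ℂ) ^ (-1 : ℂ)) t =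
        (Ioi (1 : ℝ)).indicator (fun t : ℝ => (t : ℂ) ^ (s - 2)) t := by
      intro t ht
      by_cases h1 : t ∈ Ioi (1 : ℝ)
      · rw [indicator_of_mem h1, indicator_of_mem h1, smul_eq_mul,
          ← Complex.cpow_add _ _ (Complex.ofReal_ne_zero.2 (ne_of_gt ht))]
        ring_nf
      · rw [indicator_of_notMem h1, indicator_of_notMem h1, smul_zero]
    have hsub : Ioi (0 : ℝ) ∩ Ioi 1 = Ioi 1 := inter_eq_right.2 (Ioi_subset_Ioi zero_le_one)
    constructor
    · rw [MellinConvergent, integrableOn_congr_fun e measurableSet_Ioi]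
      exact ((integrableOn_Ioi_cpow_of_lt hre one_pos).integrable_indicator
        measurableSet_Ioi).integrableOn
    · rw [mellin, setIntegral_congr_fun measurableSet_Ioi e, setIntegral_indicator
        measurableSet_Ioi, hsub, integral_Ioi_cpow_of_lt hre one_pos]
      have : s - 2 + 1 = s - 1 := by ring
      rw [this]
      simp
      ring
  have h := hasMellin_sub (mellinConvergent_boseTrunc hs0) htail.1
  have e : ∀ t ∈ Ioi (0 : ℝ), boseTrunc t -
      (Ioi (1 : ℝ)).indicator (fun t : ℝ => (t : ℂ) ^ (-1 : ℂ)) t = (boseReg t : ℂ) := by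
    intro t ht
    rcases le_or_gt t 1 with h1 | h1
    · rw [boseTrunc_of_mem_Ioc ⟨ht, h1⟩, indicator_of_notMem (notMem_Ioi.2 h1), sub_zero]
    · rw [boseTrunc_of_one_lt h1, indicator_of_mem (mem_Ioi.2 h1), Complex.cpow_neg_one, boseReg]
      push_cast
      rw [one_div]
  have e' : ∀ t ∈ Ioi (0 : ℝ), (t : ℂ) ^ (s - 1) • (boseTrunc t -
      (Ioi (1 : ℝ)).indicator (fun t : ℝ => (t : ℂ) ^ (-1 : ℂ)) t) =
      (t : ℂ) ^ (s - 1) • (boseReg t : ℂ) := fun t ht => by rw [e t ht]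
  constructor
  · exact (integrableOn_congr_fun e' measurableSet_Ioi).1 h.1
  · have hm := h.2
    rw [mellin, setIntegral_congr_fun measurableSet_Ioi e', htail.2] at hm
    have hb := mellin_boseTrunc hs0
    have hne : s - 1 ≠ 0 := sub_ne_zero.2 hs
    rw [mellin, hm, riemannZeta_eq_inv_sub_mul hs]
    field_simp
    linear_combination hb

end RamanujanXi

/-! ### The constant (γ - log 2πa)/2 and the bilinear form of `side` -/

namespace RamanujanXi

open Set Filter Topology MeasureTheory Asymptotics

/-- The combination of Bose–Einstein kernels whose integral is `(γ - log (2πa)) / 2`. -/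
noncomputable def boseMix (a x : ℝ) : ℝ := a * bose (a * x) / 2 + boseReg x / x

/-- In this grouping the poles at 0 have cancelled: each summand is bounded. -/
lemma boseMix_eq {a x : ℝ} (ha : 0 < a) (hx : 0 < x) :
    boseMix a x = a * boseReg (a * x) / 2 + (boseReg x + 1 / 2) / x := by
  unfold boseMix
  rw [boseReg.eq_def (a * x)]
  field_simp
  ring

lemma abs_boseMix_le {a x : ℝ} (ha : 0 < a) (hx : 0 < x) : |boseMix a x| ≤ (a + 1) / 4 := by
  have hax : 0 < a * x := by positivity
  rw [boseMix_eq ha hx]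
  have h1 := neg_half_le_boseReg hax
  have h2 := boseReg_nonpos hax
  have h3 := boseReg_add_half_nonneg hx
  have h4 := boseReg_add_half_le hx
  have h5 : (boseReg x + 1 / 2) / x ≤ 1 / 4 := by
    rw [div_le_iff₀ hx]
    linarith
  have h6 : 0 ≤ (boseReg x + 1 / 2) / x := by positivity
  rw [abs_le]
  constructor <;> nlinarith

lemma abs_boseMix_le_div_sq {a x : ℝ} (ha : 0 < a) (hx : 0 < x) :
    |boseMix a x| ≤ (1 / a + 1) / x ^ 2 := by
  have hax : 0 < a * x := by positivity
  have h1 : |a * bose (a * x) / 2| ≤ 1 / a / x ^ 2 := by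
    have := bose_pos hax
    rw [abs_of_pos (by positivity)]
    calc a * bose (a * x) / 2 ≤ a * (2 / (a * x) ^ 2) / 2 := by
          gcongr
          exact bose_le_two_div_sq hax
      _ = 1 / a / x ^ 2 := by field_simp
  have h2 : |boseReg x / x| ≤ 1 / x ^ 2 := by
    rw [abs_div, abs_of_pos hx]
    calc |boseReg x| / x ≤ 1 / x / x := by
          gcongr
          exact abs_boseReg_le_inv hx
      _ = 1 / x ^ 2 := by field_simp
  calc |boseMix a x| ≤ _ := abs_add_le _ _
    _ ≤ 1 / a / x ^ 2 + 1 / x ^ 2 := add_le_add h1 h2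
    _ = (1 / a + 1) / x ^ 2 := by ring

/-- An integrable majorant for `x ^ σ * boseMix a x` with `0 ≤ σ ≤ 1 / 2`. -/
noncomputable def boseMixBound (a x : ℝ) : ℝ :=
  (Ioc (0 : ℝ) 1).indicator (fun _ => (a + 1) / 4) x +
    (Ioi (1 : ℝ)).indicator (fun x => (1 / a + 1) * x ^ (-(3 / 2) : ℝ)) x

lemma integrable_boseMixBound (a : ℝ) : Integrable (boseMixBound a) := by
  refine Integrable.add ?_ ?_
  · exact (integrableOn_const (by simp)).integrable_indicator measurableSet_Ioc
  · have h := integrableOn_Ioi_rpow_of_lt (show (-(3 / 2) : ℝ) < -1 by norm_num) one_pos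
    exact IntegrableOn.integrable_indicator (h.const_mul _) measurableSet_Ioi

lemma rpow_mul_abs_boseMix_le {a x σ : ℝ} (ha : 0 < a) (hx : 0 < x) (h0 : 0 ≤ σ)
    (h1 : σ ≤ 1 / 2) : x ^ σ * |boseMix a x| ≤ boseMixBound a x := by
  unfold boseMixBound
  rcases le_or_gt x 1 with h | h
  · rw [indicator_of_mem (mem_Ioc.2 ⟨hx, h⟩), indicator_of_notMem (notMem_Ioi.2 h), add_zero]
    calc x ^ σ * |boseMix a x| ≤ 1 * ((a + 1) / 4) :=
          mul_le_mul (Real.rpow_le_one hx.le h h0) (abs_boseMix_le ha hx) (abs_nonneg _) zero_le_one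
      _ = _ := one_mul _
  · rw [indicator_of_mem (mem_Ioi.2 h), indicator_of_notMem (fun h' => h.not_ge h'.2), zero_add]
    calc x ^ σ * |boseMix a x| ≤ x ^ (1 / 2 : ℝ) * ((1 / a + 1) / x ^ 2) :=
          mul_le_mul (Real.rpow_le_rpow_of_exponent_le h.le h1) (abs_boseMix_le_div_sq ha hx)
            (abs_nonneg _) (by positivity)
      _ = (1 / a + 1) * (x ^ (1 / 2 : ℝ) / x ^ (2 : ℝ)) := by
          rw [Real.rpow_two]
          ring
      _ = _ := by
          rw [← Real.rpow_sub hx]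
          norm_num

lemma measurable_boseMix (a : ℝ) : Measurable (boseMix a) := by
  unfold boseMix
  have := measurable_bose
  have := measurable_boseReg
  fun_prop

lemma integrableOn_boseMix {a : ℝ} (ha : 0 < a) : IntegrableOn (boseMix a) (Ioi 0) := by
  refine (integrable_boseMixBound a).integrableOn.mono' (measurable_boseMix a).aestronglyMeasurable
    ((ae_restrict_mem measurableSet_Ioi).mono fun x hx => ?_)
  simpa using rpow_mul_abs_boseMix_le ha hx le_rfl (by norm_num)

/-- The integral is a Mellin transform at s = 1, where the two pieces of `boseMix` diverge
separately. Both converge at 1 + σ with 0 < σ < 1, hence the limit from the right. -/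
lemma tendsto_mellin_boseMix {a : ℝ} (ha : 0 < a) :
    Tendsto (fun σ : ℝ => mellin (fun x => (boseMix a x : ℂ)) (1 + σ)) (𝓝[>] 0)
      (𝓝 ((∫ x in Ioi 0, boseMix a x : ℝ) : ℂ)) := by
  have e : ((∫ x in Ioi 0, boseMix a x : ℝ) : ℂ) = ∫ x in Ioi 0, (boseMix a x : ℂ) :=
    integral_ofReal.symm
  rw [e]
  have hm := Complex.measurable_ofReal.comp (measurable_boseMix a)
  refine tendsto_integral_filter_of_dominated_convergence (boseMixBound a) ?_ ?_
    (integrable_boseMixBound a).integrableOn ?_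
  · refine Eventually.of_forall fun σ => ?_
    exact Measurable.aestronglyMeasurable
      ((Complex.measurable_ofReal.pow_const _).smul hm)
  · filter_upwards [Ioc_mem_nhdsGT (show (0 : ℝ) < 1 / 2 by norm_num)] with σ hσ
    refine (ae_restrict_mem measurableSet_Ioi).mono fun x hx => ?_
    rw [norm_smul, Complex.norm_cpow_eq_rpow_re_of_pos hx, Complex.norm_real]
    simpa using rpow_mul_abs_boseMix_le ha hx hσ.1.le hσ.2
  · refine (ae_restrict_mem measurableSet_Ioi).mono fun x hx => ?_
    have hx0 : (x : ℂ) ≠ 0 := Complex.ofReal_ne_zero.2 (ne_of_gt hx)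
    have hc : Continuous fun σ : ℝ => (x : ℂ) ^ ((1 : ℂ) + σ - 1) • (boseMix a x : ℂ) := by
      have : NeZero (x : ℂ) := ⟨hx0⟩
      fun_prop
    have := (hc.tendsto 0).mono_left (nhdsWithin_le_nhds (s := Ioi 0))
    simpa using this

/-- The terms are grouped so that each has a limit as σ → 0: a regularised ζ(1 + σ) and two
difference quotients at 0. The 1/σ poles cancel because ζ(0) = -1/2. -/
lemma mellin_boseMix {a σ : ℝ} (ha : 0 < a) (h0 : 0 < σ) (h1 : σ < 1) :
    mellin (fun x => (boseMix a x : ℂ)) (1 + σ) =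
      Complex.Gamma (1 + σ) * (1 / 2 * ((a : ℂ) ^ (-(σ : ℂ)) *
        (riemannZeta (1 + σ) - 1 / (1 + σ - 1))) +
        1 / 2 * ((σ : ℂ)⁻¹ * ((a : ℂ) ^ (-(σ : ℂ)) - 1)) +
        (σ : ℂ)⁻¹ * (riemannZeta σ - riemannZeta 0)) := by
  have hre : 1 < ((1 : ℂ) + σ).re := by simpa using h0
  have hσ : (σ : ℂ) ≠ 0 := Complex.ofReal_ne_zero.2 h0.ne'
  have ha' : (a : ℂ) ≠ 0 := Complex.ofReal_ne_zero.2 ha.ne'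
  have c1 : MellinConvergent (fun x => (bose (a * x) : ℂ)) (1 + σ) :=
    (MellinConvergent.comp_mul_left (f := fun x => (bose x : ℂ)) ha).2 (mellinConvergent_bose hre)
  have c2 := hasMellin_boseReg (s := σ) (by simpa using h0) (by simpa using h1)
  have e2 : (1 : ℂ) + σ + (-1) = σ := by ring
  have c2' : MellinConvergent (fun x : ℝ => (x : ℂ) ^ (-1 : ℂ) • (boseReg x : ℂ)) (1 + σ) := by
    rw [MellinConvergent.cpow_smul, e2]
    exact c2.1
  have h := (hasMellin_add (c1.const_smul ((a : ℂ) / 2)) c2').2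
  have e : (fun x => (boseMix a x : ℂ)) = fun x => ((a : ℂ) / 2) • (bose (a * x) : ℂ) +
      (x : ℂ) ^ (-1 : ℂ) • (boseReg x : ℂ) := by
    ext x
    rw [boseMix, Complex.cpow_neg_one]
    push_cast
    simp only [smul_eq_mul]
    ring
  have m1 := mellin_comp_mul_left (fun x => (bose x : ℂ)) (1 + (σ : ℂ)) ha
  rw [e, h, mellin_const_smul, m1, mellin_bose hre, mellin_cpow_smul, e2, c2.2, riemannZeta_zero]
  have e3 : (a : ℂ) ^ (-(1 + (σ : ℂ))) = (a : ℂ)⁻¹ * (a : ℂ) ^ (-(σ : ℂ)) := by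
    rw [neg_add, Complex.cpow_add _ _ ha', Complex.cpow_neg_one]
  have e4 : Complex.Gamma (1 + σ) = σ * Complex.Gamma σ := by
    rw [add_comm, Complex.Gamma_add_one _ hσ]
  simp only [smul_eq_mul]
  rw [e3, e4, add_sub_cancel_left]
  field_simp
  ring

/-- The three limits are γ, -log a and ζ'(0) = -log(2π)/2. -/
lemma integral_boseMix {a : ℝ} (ha : 0 < a) :
    ∫ x in Ioi 0, boseMix a x =
      (Real.eulerMascheroniConstant - Real.log (2 * Real.pi * a)) / 2 := by
  have ha' : (a : ℂ) ≠ 0 := Complex.ofReal_ne_zero.2 ha.ne'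
  have t0 : Tendsto (fun σ : ℝ => (σ : ℂ)) (𝓝[>] 0) (𝓝[≠] 0) := by
    refine tendsto_nhdsWithin_iff.2 ⟨?_, ?_⟩
    · exact (Complex.continuous_ofReal.tendsto' 0 0 rfl).mono_left nhdsWithin_le_nhds
    · filter_upwards [self_mem_nhdsWithin] with σ hσ
      exact Complex.ofReal_ne_zero.2 (ne_of_gt hσ)
  have t1 : Tendsto (fun σ : ℝ => (1 : ℂ) + σ) (𝓝[>] 0) (𝓝[≠] 1) := by
    refine tendsto_nhdsWithin_iff.2 ⟨?_, ?_⟩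
    · have := (t0.mono_right nhdsWithin_le_nhds).const_add (1 : ℂ)
      simpa using this
    · filter_upwards [self_mem_nhdsWithin] with σ hσ
      simpa using ne_of_gt hσ
  have hp : HasDerivAt (fun z : ℂ => (a : ℂ) ^ (-z)) (-Complex.log a) 0 := by
    have := (hasDerivAt_neg (0 : ℂ)).const_cpow (c := (a : ℂ)) (Or.inl ha')
    simpa using this
  have l1 := tendsto_riemannZeta_sub_one_div.comp t1
  have l2 := (hasDerivAt_iff_tendsto_slope_zero.1 hp).comp t0
  have l3 := (hasDerivAt_iff_tendsto_slope_zero.1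
    (differentiableAt_riemannZeta zero_ne_one).hasDerivAt).comp t0
  have l4 : Tendsto (fun σ : ℝ => (a : ℂ) ^ (-(σ : ℂ))) (𝓝[>] 0) (𝓝 1) := by
    have := (hp.continuousAt.tendsto.mono_left nhdsWithin_le_nhds).comp t0
    simpa [Function.comp_def] using this
  have l5 : Tendsto (fun σ : ℝ => Complex.Gamma (1 + σ)) (𝓝[>] 0) (𝓝 1) := by
    have := ((Complex.differentiableAt_Gamma 1 fun m h => by
      have h' := congrArg Complex.re h
      have := Nat.cast_nonneg (α := ℝ) m
      simp at h'
      linarith).continuousAt.tendsto.mono_left nhdsWithin_le_nhds).comp t1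
    simpa [Function.comp_def] using this
  have hlim := l5.mul ((((l4.mul l1).const_mul (1 / 2)).add (l2.const_mul (1 / 2))).add l3)
  have hm := tendsto_mellin_boseMix ha
  have hu := tendsto_nhds_unique_of_eventuallyEq hm hlim (by
    filter_upwards [Ioo_mem_nhdsGT (zero_lt_one' ℝ)] with σ hσ
    rw [mellin_boseMix ha hσ.1 hσ.2]
    simp)
  have hlog : Real.log (2 * Real.pi * a) = Real.log (2 * Real.pi) + Real.log a :=
    Real.log_mul (by positivity) ha.ne'
  apply Complex.ofReal_injective
  rw [hu, deriv_riemannZeta_zero, hlog]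
  push_cast
  rw [Complex.ofReal_log ha.le, Complex.ofReal_log (by positivity)]
  push_cast
  ring

/-- Substituting `bose (a * x)` = `boseReg (a * x)` + 1/(ax) leaves the remainder `boseMix a x` / a,
whose integral cancels the explicit term of `side`. -/
lemma side_eq {a : ℝ} (ha : 0 < a)
    (hint : IntegrableOn (fun x => boseReg x * boseReg (a * x)) (Ioi 0)) :
    side a = -(√a * ∫ x in Ioi 0, boseReg x * boseReg (a * x)) := by
  have e : ∀ x ∈ Ioi (0 : ℝ), (boseReg x + 1 / 2) * bose (a * x) =
      boseReg x * boseReg (a * x) + 1 / a * boseMix a x := by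
    intro x hx
    have hx' : x ≠ 0 := ne_of_gt hx
    rw [boseMix, boseReg.eq_def (a * x)]
    field_simp
    ring
  rw [side, (hasSum_phi ha).tsum_eq, setIntegral_congr_fun measurableSet_Ioi e,
    integral_add hint ((integrableOn_boseMix ha).const_mul _), integral_const_mul,
    integral_boseMix ha]
  field_simp
  ring

end RamanujanXi

/-! ### Parseval on the critical line, in logarithmic coordinates -/

namespace RamanujanXi

open Set Filter Topology MeasureTheory FourierTransform Complex

/-- The regularised Bose–Einstein kernel in logarithmic coordinates, with weight `e^{-u/2}`. -/
noncomputable def boseLog (u : ℝ) : ℝ := Real.exp (-(1 / 2) * u) * boseReg (Real.exp (-u))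

lemma integrable_exp_neg_half_abs : Integrable fun u : ℝ => Real.exp (-(1 / 2) * |u|) := by
  rw [← integrableOn_univ, ← Iic_union_Ioi (a := (0 : ℝ)), integrableOn_union]
  constructor
  · refine (integrableOn_exp_mul_Iic (show (0 : ℝ) < 1 / 2 by norm_num) 0).congr_fun
      (fun u hu => ?_) measurableSet_Iic
    rw [abs_of_nonpos (mem_Iic.1 hu)]
    ring_nf
  · refine (integrableOn_exp_mul_Ioi (show (-(1 / 2) : ℝ) < 0 by norm_num) 0).congr_fun
      (fun u hu => ?_) measurableSet_Ioi
    rw [abs_of_pos (mem_Ioi.1 hu)]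

lemma abs_boseLog_le (u : ℝ) : |boseLog u| ≤ Real.exp (-(1 / 2) * |u|) := by
  have hp := Real.exp_pos (-u)
  rw [boseLog, abs_mul, abs_of_pos (Real.exp_pos _)]
  rcases le_total 0 u with h | h
  · rw [abs_of_nonneg h]
    exact mul_le_of_le_one_right (Real.exp_pos _).le ((abs_boseReg_le_half hp).trans (by norm_num))
  · calc Real.exp (-(1 / 2) * u) * |boseReg (Real.exp (-u))|
        ≤ Real.exp (-(1 / 2) * u) * (1 / Real.exp (-u)) := by
          gcongr
          exact abs_boseReg_le_inv hp
      _ = Real.exp (-(1 / 2) * |u|) := by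
          rw [abs_of_nonpos h, one_div (Real.exp _), ← Real.exp_neg, ← Real.exp_add]
          ring_nf

lemma hasDerivAt_boseLog (u : ℝ) : HasDerivAt boseLog
    (-(1 / 2) * boseLog u - Real.exp (-(3 / 2) * u) *
      (1 / Real.exp (-u) ^ 2 - bose (Real.exp (-u)) - bose (Real.exp (-u)) ^ 2)) u := by
  have h1 : HasDerivAt (fun u : ℝ => Real.exp (-(1 / 2) * u))
      (Real.exp (-(1 / 2) * u) * (-(1 / 2))) u := by
    have := ((hasDerivAt_id u).const_mul (-(1 / 2) : ℝ)).exp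
    simpa using this
  have h2 : HasDerivAt (fun u : ℝ => Real.exp (-u)) (-Real.exp (-u)) u := by
    have := (hasDerivAt_neg u).exp
    simpa using this
  refine (h1.mul ((hasDerivAt_boseReg (Real.exp_pos (-u))).comp u h2)).congr_deriv ?_
  have : Real.exp (-(3 / 2) * u) = Real.exp (-(1 / 2) * u) * Real.exp (-u) := by
    rw [← Real.exp_add]
    ring_nf
  rw [this, boseLog]
  simp only [Function.comp]
  ring

/-- Integrability of the derivative is what gives the Fourier transform its 1/w decay. -/
lemma abs_deriv_boseLog_le (u : ℝ) : |deriv boseLog u| ≤ 5 * Real.exp (-(1 / 2) * |u|) := by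
  have hp := Real.exp_pos (-u)
  rw [(hasDerivAt_boseLog u).deriv]
  set d := 1 / Real.exp (-u) ^ 2 - bose (Real.exp (-u)) - bose (Real.exp (-u)) ^ 2 with hd
  have h1 : |-(1 / 2) * boseLog u| ≤ Real.exp (-(1 / 2) * |u|) := by
    have := abs_boseLog_le u
    have h2 : |(-(1 / 2) : ℝ)| = 1 / 2 := by norm_num
    rw [abs_mul, h2]
    linarith [abs_nonneg (boseLog u)]
  have h2 : |Real.exp (-(3 / 2) * u) * d| ≤ 4 * Real.exp (-(1 / 2) * |u|) := by
    rw [abs_mul, abs_of_pos (Real.exp_pos _)]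
    rcases le_total 0 u with h | h
    · rw [abs_of_nonneg h]
      have : Real.exp (-(3 / 2) * u) ≤ Real.exp (-(1 / 2) * u) :=
        Real.exp_le_exp.2 (by linarith)
      have hd' := abs_deriv_boseReg_le_half hp
      calc Real.exp (-(3 / 2) * u) * |d| ≤ Real.exp (-(1 / 2) * u) * (1 / 2) := by gcongr
        _ ≤ _ := by linarith [Real.exp_pos (-(1 / 2) * u)]
    · have h3 : 1 ≤ Real.exp (-u) := Real.one_le_exp (by linarith)
      calc Real.exp (-(3 / 2) * u) * |d| ≤ Real.exp (-(3 / 2) * u) * (4 / Real.exp (-u) ^ 2) := by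
            gcongr
            exact abs_deriv_boseReg_le_div_sq h3
        _ = 4 * Real.exp (-(1 / 2) * |u|) := by
            rw [abs_of_nonpos h, ← Real.exp_nat_mul, div_eq_mul_inv 4, ← Real.exp_neg,
              mul_left_comm, ← Real.exp_add]
            push_cast
            ring_nf
  have h3 := norm_sub_le (-(1 / 2) * boseLog u) (Real.exp (-(3 / 2) * u) * d)
  simp only [Real.norm_eq_abs] at h3
  linarith

lemma differentiable_boseLog : Differentiable ℝ boseLog := fun u =>
  (hasDerivAt_boseLog u).differentiableAt

lemma integrable_boseLog : Integrable fun u => (boseLog u : ℂ) :=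
  Integrable.ofReal (integrable_exp_neg_half_abs.mono'
    differentiable_boseLog.continuous.aestronglyMeasurable (ae_of_all _ abs_boseLog_le))

lemma deriv_ofReal_boseLog : deriv (fun u => (boseLog u : ℂ)) = fun u => ((deriv boseLog u : ℝ) : ℂ) :=
  funext fun u => (differentiable_boseLog u).hasDerivAt.ofReal_comp.deriv

lemma integrable_deriv_boseLog : Integrable (deriv fun u => (boseLog u : ℂ)) := by
  rw [deriv_ofReal_boseLog]
  exact Integrable.ofReal ((integrable_exp_neg_half_abs.const_mul 5).mono'
    (measurable_deriv _).aestronglyMeasurable (ae_of_all _ abs_deriv_boseLog_le))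

/-- `Γ(s) ζ(s)` on the critical line. -/
noncomputable def gammaZeta (u : ℝ) : ℂ :=
  Gamma (1 / 2 + I * u) * riemannZeta (1 / 2 + I * u)

lemma continuous_gammaZeta : Continuous gammaZeta := by
  refine continuous_iff_continuousAt.2 fun u => ContinuousAt.mul ?_ ?_
  · refine ContinuousAt.comp (f := fun u : ℝ => (1 / 2 + I * u : ℂ))
      (differentiableAt_Gamma _ fun m h => ?_).continuousAt (by fun_prop)
    have h' := congrArg re h
    have := Nat.cast_nonneg (α := ℝ) m
    simp at h'
    linarith
  · refine ContinuousAt.comp (f := fun u : ℝ => (1 / 2 + I * u : ℂ))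
      (differentiableAt_riemannZeta fun h => ?_).continuousAt (by fun_prop)
    have h' := congrArg re h
    norm_num at h'

lemma gammaZeta_neg (u : ℝ) : gammaZeta (-u) = (starRingEnd ℂ) (gammaZeta u) := by
  have e : (1 / 2 + I * ((-u : ℝ) : ℂ) : ℂ) = (starRingEnd ℂ) (1 / 2 + I * u) := by
    simp [conj_ofNat]
  rw [gammaZeta, e, Gamma_conj, riemannZeta_conj, gammaZeta, map_mul]

lemma fourier_boseLog (w : ℝ) : 𝓕 (fun u => (boseLog u : ℂ)) w = gammaZeta (2 * Real.pi * w) := by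
  have hre : (1 / 2 + I * ((2 * Real.pi * w : ℝ) : ℂ)).re = 1 / 2 := by simp
  have him : (1 / 2 + I * ((2 * Real.pi * w : ℝ) : ℂ)).im = 2 * Real.pi * w := by simp
  have h := (hasMellin_boseReg (s := 1 / 2 + I * ((2 * Real.pi * w : ℝ) : ℂ))
    (by rw [hre]; norm_num) (by rw [hre]; norm_num)).2
  rw [mellin_eq_fourier, hre, him, mul_div_cancel_left₀ _ (by positivity)] at h
  rw [gammaZeta, ← h]
  refine congrFun (congrArg 𝓕 (funext fun u => ?_)) w
  rw [boseLog, real_smul]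
  push_cast
  rfl

lemma norm_fourier_le (f : ℝ → ℂ) (w : ℝ) : ‖𝓕 f w‖ ≤ ∫ u, ‖f u‖ := by
  rw [Real.fourier_real_eq]
  refine (norm_integral_le_integral_norm _).trans_eq (integral_congr_ae (ae_of_all _ fun u => ?_))
  exact Circle.norm_smul _ _

/-- No growth estimate for Γ or ζ is needed: the L¹ norms A and B of `boseLog` and its derivative
bound the transform and |w| times it, so its square is at most (A² + B²)/(1 + w²). -/
lemma integrable_gammaZeta_sq : Integrable fun w : ℝ => ‖gammaZeta (2 * Real.pi * w)‖ ^ 2 := by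
  set A := ∫ u, ‖(boseLog u : ℂ)‖
  set B := ∫ u, ‖deriv (fun u => (boseLog u : ℂ)) u‖
  refine (integrable_inv_one_add_sq.const_mul (A ^ 2 + B ^ 2)).mono' ?_ (ae_of_all _ fun w => ?_)
  · exact ((continuous_gammaZeta.comp (continuous_const.mul continuous_id)).norm.pow
      2).aestronglyMeasurable
  · have h1 := norm_fourier_le (fun u => (boseLog u : ℂ)) w
    have h2 := norm_fourier_le (deriv fun u => (boseLog u : ℂ)) w
    rw [Real.fourier_deriv integrable_boseLog
      (fun u => (differentiable_boseLog u).hasDerivAt.ofReal_comp.differentiableAt)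
      integrable_deriv_boseLog] at h2
    rw [fourier_boseLog] at h1
    simp only [fourier_boseLog] at h2
    rw [norm_smul] at h2
    have hn : |w| ≤ ‖(2 * Real.pi * I * w : ℂ)‖ := by
      simp only [norm_mul, norm_I, norm_real, Real.norm_eq_abs, abs_of_pos Real.pi_pos, mul_one]
      have : 1 ≤ 2 * Real.pi := by linarith [Real.pi_gt_three]
      norm_num
      nlinarith [abs_nonneg w]
    set G := ‖gammaZeta (2 * Real.pi * w)‖
    have hG : 0 ≤ G := norm_nonneg _
    have h3 : |w| * G ≤ B := (mul_le_mul_of_nonneg_right hn hG).trans h2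
    have h4 : G ^ 2 ≤ A ^ 2 := pow_le_pow_left₀ hG h1 2
    have h5 : (|w| * G) ^ 2 ≤ B ^ 2 := pow_le_pow_left₀ (by positivity) h3 2
    rw [mul_pow, sq_abs] at h5
    rw [Real.norm_of_nonneg (by positivity), ← div_eq_mul_inv, le_div_iff₀ (by positivity)]
    linarith

/-- The autocorrelation of `boseLog`. -/
noncomputable def boseCorr : ℝ → ℂ :=
  convolution (fun u => (boseLog u : ℂ)) (fun u => (boseLog (-u) : ℂ))
    (ContinuousLinearMap.mul ℂ ℂ) volume

lemma integrable_boseLog_neg : Integrable fun u => (boseLog (-u) : ℂ) := integrable_boseLog.comp_neg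

lemma fourier_boseCorr (w : ℝ) :
    𝓕 boseCorr w = ((‖gammaZeta (2 * Real.pi * w)‖ ^ 2 : ℝ) : ℂ) := by
  have h : 𝓕 (fun u => (boseLog (-u) : ℂ)) w = gammaZeta (-(2 * Real.pi * w)) := by
    rw [← Real.fourierInv_eq_fourier_comp_neg (fun u => (boseLog u : ℂ)),
      Real.fourierInv_eq_fourier_neg, fourier_boseLog]
    ring_nf
  rw [boseCorr, Real.fourier_mul_convolution_eq integrable_boseLog integrable_boseLog_neg,
    fourier_boseLog, h, gammaZeta_neg, mul_conj, normSq_eq_norm_sq]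

lemma continuous_boseCorr : Continuous boseCorr := by
  refine BddAbove.continuous_convolution_right_of_integrable _ ⟨1, ?_⟩ integrable_boseLog ?_
  · rintro _ ⟨u, rfl⟩
    have h := abs_boseLog_le (-u)
    have : Real.exp (-(1 / 2) * |(-u)|) ≤ 1 := Real.exp_le_one_iff.2 (by
      have := abs_nonneg (-u)
      linarith)
    simpa only [norm_real, Real.norm_eq_abs] using h.trans this
  · have := differentiable_boseLog.continuous
    fun_prop

/-- Parseval is needed at each individual shift, so it is obtained by pointwise Fourier inversion of
the continuous autocorrelation, whose transform is integrable. -/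
lemma boseCorr_eq_integral (v : ℝ) :
    boseCorr v = ∫ w : ℝ, exp (2 * Real.pi * (w * v) * I) *
      ((‖gammaZeta (2 * Real.pi * w)‖ ^ 2 : ℝ) : ℂ) := by
  have hF : 𝓕 boseCorr = fun w : ℝ => ((‖gammaZeta (2 * Real.pi * w)‖ ^ 2 : ℝ) : ℂ) :=
    funext fourier_boseCorr
  have hi : Integrable (𝓕 boseCorr) := by
    rw [hF]
    exact integrable_gammaZeta_sq.ofReal
  have h := continuous_boseCorr.fourierInv_fourier_eq
    (integrable_boseLog.integrable_convolution _ integrable_boseLog_neg) hi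
  rw [← congrFun h v, Real.fourierInv_eq', hF]
  refine integral_congr_ae (ae_of_all _ fun w => ?_)
  simp [mul_comm, mul_assoc]

lemma integral_exp_neg_comp {f : ℝ → ℂ} :
    ∫ u : ℝ, (Real.exp (-u) : ℂ) * f (Real.exp (-u)) = ∫ x in Ioi 0, f x := by
  -- At s = 1 the Mellin power and the Fourier phase are both trivial, leaving the substitution x =
  -- e^{-u}.
  have h := mellin_eq_fourier f (s := 1)
  rw [Real.fourier_real_eq, mellin] at h
  simpa using h.symm

lemma integrableOn_boseReg_mul {a : ℝ} (ha : 0 < a) :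
    IntegrableOn (fun x => boseReg x * boseReg (a * x)) (Ioi 0) := by
  have hm : Measurable fun x => boseReg x * boseReg (a * x) := by
    have := measurable_boseReg
    fun_prop
  rw [← Ioc_union_Ioi_eq_Ioi zero_le_one, integrableOn_union]
  constructor
  · refine Integrable.mono' (g := fun _ => (1 / 2 * (1 / 2) : ℝ)) (integrableOn_const (by simp))
      hm.aestronglyMeasurable ((ae_restrict_mem measurableSet_Ioc).mono fun x hx => ?_)
    rw [norm_mul]
    exact mul_le_mul (abs_boseReg_le_half hx.1) (abs_boseReg_le_half (mul_pos ha hx.1))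
      (abs_nonneg _) (by norm_num)
  · refine Integrable.mono' (g := fun x : ℝ => 1 / a * x ^ (-2 : ℝ))
      ((integrableOn_Ioi_rpow_of_lt (by norm_num) one_pos).const_mul _)
      hm.aestronglyMeasurable ((ae_restrict_mem measurableSet_Ioi).mono fun x hx => ?_)
    have hx0 : 0 < x := zero_lt_one.trans hx
    rw [norm_mul]
    calc ‖boseReg x‖ * ‖boseReg (a * x)‖ ≤ 1 / x * (1 / (a * x)) :=
          mul_le_mul (abs_boseReg_le_inv hx0) (abs_boseReg_le_inv (mul_pos ha hx0))
            (abs_nonneg _) (by positivity)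
      _ = 1 / a * x ^ (-2 : ℝ) := by
          rw [Real.rpow_neg hx0.le, Real.rpow_two]
          field_simp

/-- Under x = e^{-u} a shift by log a becomes dilation by a, and the two half-weights multiply to √a
e^{-u}. -/
lemma boseCorr_log {a : ℝ} (ha : 0 < a) :
    boseCorr (Real.log a) = ((√a * ∫ x in Ioi 0, boseReg x * boseReg (a * x) : ℝ) : ℂ) := by
  have h := integral_exp_neg_comp (f := fun x => ((boseReg x * boseReg (a * x) : ℝ) : ℂ))
  rw [integral_complex_ofReal] at h
  rw [ofReal_mul, ← h, ← integral_const_mul, boseCorr, convolution_def]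
  refine integral_congr_ae (ae_of_all _ fun u => ?_)
  simp only [ContinuousLinearMap.mul_apply']
  norm_cast
  rw [boseLog, boseLog, neg_sub, neg_sub, Real.exp_sub, Real.exp_log ha, Real.exp_neg u]
  have e : √a = Real.exp (1 / 2 * Real.log a) := by
    rw [Real.sqrt_eq_rpow, Real.rpow_def_of_pos ha, mul_comm]
  have e1 : Real.exp (-(1 / 2) * u) * Real.exp (-(1 / 2) * (u - Real.log a)) =
      √a * (Real.exp u)⁻¹ := by
    rw [e, ← Real.exp_neg, ← Real.exp_add, ← Real.exp_add]
    ring_nf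
  rw [div_eq_mul_inv a]
  linear_combination (boseReg (Real.exp u)⁻¹ * boseReg (a * (Real.exp u)⁻¹)) * e1

lemma integrable_norm_gammaZeta_sq : Integrable fun u : ℝ => ‖gammaZeta u‖ ^ 2 :=
  (integrable_comp_mul_left_iff (fun u : ℝ => ‖gammaZeta u‖ ^ 2)
    (by positivity : 2 * Real.pi ≠ 0)).1 integrable_gammaZeta_sq

lemma integrable_gammaZeta_mul_cos (v : ℝ) :
    Integrable fun u : ℝ => ‖gammaZeta u‖ ^ 2 * Real.cos (u * v) := by
  refine integrable_norm_gammaZeta_sq.mul_bdd (c := 1) ?_ (ae_of_all _ fun u => Real.abs_cos_le_one _)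
  exact Continuous.aestronglyMeasurable (by fun_prop)

/-- Parseval's formula for the Mellin transform of the regularised Bose–Einstein kernel. -/
theorem sqrt_mul_integral_boseReg {a : ℝ} (ha : 0 < a) :
    Real.pi * (√a * ∫ x in Ioi 0, boseReg x * boseReg (a * x)) =
      ∫ u in Ioi 0, ‖gammaZeta u‖ ^ 2 * Real.cos (u * Real.log a) := by
  set v := Real.log a with hv
  have h := congrArg re ((boseCorr_log ha).symm.trans (boseCorr_eq_integral (Real.log a)))
  have hi : Integrable fun w : ℝ => exp (2 * Real.pi * (w * v) * I) *
      ((‖gammaZeta (2 * Real.pi * w)‖ ^ 2 : ℝ) : ℂ) := by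
    refine integrable_gammaZeta_sq.ofReal.bdd_mul (c := 1)
      (Continuous.aestronglyMeasurable (by fun_prop)) (ae_of_all _ fun w => ?_)
    have : (2 * Real.pi * (w * v) * I : ℂ) = ((2 * Real.pi * (w * v) : ℝ) : ℂ) * I := by
      push_cast; rfl
    rw [this, norm_exp_ofReal_mul_I]
  rw [ofReal_re, ← hv, ← reCLM_apply, ← ContinuousLinearMap.integral_comp_comm _ hi] at h
  have e : ∀ w : ℝ, reCLM (exp (2 * Real.pi * (w * v) * I) *
      ((‖gammaZeta (2 * Real.pi * w)‖ ^ 2 : ℝ) : ℂ)) =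
      (fun u => ‖gammaZeta u‖ ^ 2 * Real.cos (u * v)) (2 * Real.pi * w) := by
    intro w
    have : (2 * Real.pi * (w * v) * I : ℂ) = ((2 * Real.pi * w * v : ℝ) : ℂ) * I := by
      push_cast; ring
    rw [reCLM_apply, re_mul_ofReal, this, exp_ofReal_mul_I_re, mul_comm]
  simp only [e] at h
  rw [Measure.integral_comp_mul_left (fun u => ‖gammaZeta u‖ ^ 2 * Real.cos (u * v))] at h
  -- Conjugation symmetry makes the integrand even; folding onto u > 0 gives the factor 2 that
  -- cancels with π and the Jacobian 1/(2π).
  have habs : ∀ u : ℝ, ‖gammaZeta u‖ ^ 2 * Real.cos (u * v) =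
      (fun u => ‖gammaZeta u‖ ^ 2 * Real.cos (u * v)) |u| := by
    intro u
    rcases abs_choice u with hu | hu
    · simp only [hu]
    · simp only [hu]
      rw [gammaZeta_neg, RCLike.norm_conj, neg_mul, Real.cos_neg]
  rw [integral_congr_ae (ae_of_all _ habs),
    integral_comp_abs (f := fun u => ‖gammaZeta u‖ ^ 2 * Real.cos (u * v)), abs_of_pos (by positivity)] at h
  have hpi : Real.pi * (2 * Real.pi)⁻¹ * 2 = 1 := by field_simp
  rw [h, smul_eq_mul, ← mul_assoc, ← mul_assoc, hpi, one_mul]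

end RamanujanXi

/-! ### From Γζ to Ξ on the critical line -/

namespace RamanujanXi

open Set Filter Topology MeasureTheory Complex

/-- With s = 1/2 + iu the extra Gamma factor is Γ((s - 1)/2). The factor s - 1 of ξ raises it to
Γ((s + 1)/2), which pairs with Γ(s/2) in the duplication formula to give Γ(s). -/
lemma Xi_mul_Gamma (u : ℝ) :
    Xi u * Gamma ((-1 + I * ((2 * u : ℝ) : ℂ)) / 4) =
      (Real.pi : ℂ) ^ (-((1 / 2 + I * u) / 2)) * (1 / 2 + I * u) * 2 ^ (1 - (1 / 2 + I * u)) *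
        (√Real.pi : ℂ) * gammaZeta u := by
  unfold gammaZeta Xi xi
  set s : ℂ := 1 / 2 + I * u with hs
  have hre : s.re = 1 / 2 := by simp [hs]
  have hs0 : s / 2 ≠ 0 := fun h => by
    have := congrArg re h
    norm_num [hre] at this
  have hs1 : (s - 1) / 2 ≠ 0 := fun h => by
    have := congrArg re h
    norm_num [hre] at this
  have e : (-1 + I * ((2 * u : ℝ) : ℂ)) / 4 = (s - 1) / 2 := by
    rw [hs]
    push_cast
    ring
  have h1 : Gamma (1 + s / 2) = s / 2 * Gamma (s / 2) := by rw [add_comm, Gamma_add_one _ hs0]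
  have h2 : Gamma (s / 2 + 1 / 2) = (s - 1) / 2 * Gamma ((s - 1) / 2) := by
    rw [← Gamma_add_one _ hs1]
    ring_nf
  have h3 := Gamma_mul_Gamma_add_half (s / 2)
  rw [mul_div_cancel₀ s two_ne_zero, h2] at h3
  rw [e, h1]
  linear_combination (s * (Real.pi : ℂ) ^ (-(s / 2)) * riemannZeta s) * h3

/-- The factor 1 + (2u)², from |s|² = (1 + 4u²)/4, is what the denominator 1 + t² of `integrand`
removes at t = 2u. -/
lemma norm_Xi_mul_Gamma_sq (u : ℝ) :
    ‖Xi u * Gamma ((-1 + I * ((2 * u : ℝ) : ℂ)) / 4)‖ ^ 2 =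
      √Real.pi / 2 * (1 + (2 * u) ^ 2) * ‖gammaZeta u‖ ^ 2 := by
  have n1 : ‖(Real.pi : ℂ) ^ (-((1 / 2 + I * u) / 2))‖ ^ 2 = (√Real.pi)⁻¹ := by
    rw [norm_cpow_eq_rpow_re_of_pos Real.pi_pos, ← Real.rpow_natCast, ← Real.rpow_mul
      Real.pi_pos.le, Real.sqrt_eq_rpow, ← Real.rpow_neg Real.pi_pos.le]
    congr 1
    simp
  have n2 : ‖(2 : ℂ) ^ (1 - (1 / 2 + I * u))‖ ^ 2 = 2 := by
    have := norm_cpow_eq_rpow_re_of_pos two_pos (1 - (1 / 2 + I * u))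
    rw [ofReal_ofNat] at this
    rw [this, ← Real.rpow_natCast, ← Real.rpow_mul two_pos.le]
    conv_rhs => rw [← Real.rpow_one 2]
    congr 1
    simp
    norm_num
  have n3 : ‖(1 / 2 + I * u : ℂ)‖ ^ 2 = (1 + (2 * u) ^ 2) / 4 := by
    rw [← normSq_eq_norm_sq, normSq_apply]
    simp
    ring
  have n4 : ‖(√Real.pi : ℂ)‖ ^ 2 = Real.pi := by
    rw [norm_real, Real.norm_eq_abs, sq_abs, Real.sq_sqrt Real.pi_pos.le]
  have n5 : (√Real.pi)⁻¹ * Real.pi = √Real.pi := by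
    have h := Real.mul_self_sqrt Real.pi_pos.le
    have : √Real.pi ≠ 0 := by positivity
    field_simp
    linarith
  rw [Xi_mul_Gamma]
  simp only [norm_mul, mul_pow]
  rw [n1, n2, n3, n4]
  linear_combination (1 / 2 * (1 + (2 * u) ^ 2) * ‖gammaZeta u‖ ^ 2) * n5

lemma integrand_two_mul (a u : ℝ) :
    integrand a (2 * u) = √Real.pi / 2 * (‖gammaZeta u‖ ^ 2 * Real.cos (u * Real.log a)) := by
  have h : (1 + (2 * u) ^ 2 : ℝ) ≠ 0 := by positivity
  rw [integrand, mul_div_cancel_left₀ u two_ne_zero, norm_Xi_mul_Gamma_sq]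
  field_simp

lemma integrableOn_integrand (a : ℝ) : IntegrableOn (integrand a) (Ioi 0) := by
  have h := integrableOn_Ioi_comp_mul_left_iff (integrand a) 0 two_pos
  rw [mul_zero] at h
  rw [← h]
  simp only [integrand_two_mul]
  exact ((integrable_gammaZeta_mul_cos _).const_mul _).integrableOn

lemma integral_integrand {a : ℝ} (ha : 0 < a) :
    ∫ t in Ioi 0, integrand a t =
      Real.pi ^ ((3 : ℝ) / 2) * (√a * ∫ x in Ioi 0, boseReg x * boseReg (a * x)) := by
  have h := integral_comp_mul_left_Ioi (integrand a) 0 two_pos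
  simp only [integrand_two_mul, mul_zero, smul_eq_mul] at h
  rw [integral_const_mul, ← sqrt_mul_integral_boseReg ha] at h
  have hp : Real.pi ^ ((3 : ℝ) / 2) = Real.pi * √Real.pi := by
    rw [Real.sqrt_eq_rpow, ← Real.rpow_one_add' Real.pi_pos.le (by norm_num)]
    norm_num
  rw [hp]
  linear_combination -2 * h

theorem side_eq_integral {a : ℝ} (ha : 0 < a) :
    side a = -(1 / Real.pi ^ ((3 : ℝ) / 2)) * ∫ t in Ioi (0 : ℝ), integrand a t := by
  have : Real.pi ^ ((3 : ℝ) / 2) ≠ 0 := by positivity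
  rw [integral_integrand ha, side_eq ha (integrableOn_boseReg_mul ha)]
  field_simp

lemma integrand_inv (a : ℝ) : integrand a⁻¹ = integrand a := by
  ext t
  rw [integrand, integrand, Real.log_inv, mul_neg, Real.cos_neg]

end RamanujanXi

theorem theorem1 (α β : ℝ) (hα : 0 < α) (hβ : 0 < β) (hαβ : α * β = 1) :
    Summable (fun n : ℕ => RamanujanXi.phi (((n : ℝ) + 1) * α)) ∧
    Summable (fun n : ℕ => RamanujanXi.phi (((n : ℝ) + 1) * β)) ∧
    MeasureTheory.IntegrableOn (RamanujanXi.integrand α) (Set.Ioi 0) ∧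
    RamanujanXi.side α = RamanujanXi.side β ∧
    RamanujanXi.side β =
      -(1 / Real.pi ^ ((3 : ℝ) / 2)) * ∫ t in Set.Ioi (0 : ℝ), RamanujanXi.integrand α t := by
  have hβ' : β = α⁻¹ := eq_inv_of_mul_eq_one_right hαβ
  have hi : RamanujanXi.integrand β = RamanujanXi.integrand α := by
    rw [hβ', RamanujanXi.integrand_inv]
  have hsα := RamanujanXi.side_eq_integral hα
  have hsβ := RamanujanXi.side_eq_integral hβ
  rw [hi] at hsβ
  exact ⟨(RamanujanXi.hasSum_phi hα).summable, (RamanujanXi.hasSum_phi hβ).summable,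
    RamanujanXi.integrableOn_integrand α, hsα.trans hsβ.symm, hsβ⟩
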